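/- Let $\kappa\in\mathbb{C}$, let $q>1$ be a real number, let $m$ be a positive integer, let $0<\beta<\alpha\le 1$, and let $\Phi_0,\dots,\Phi_{m-1}\colon\mathbb{R}\to\mathbb{C}$ be $1$-periodic Hölder continuous functions with exponent $\alpha$. Then there exist continuously differentiable $1$-periodic functions $\Psi_{-1},\Psi_0,\dots,\Psi_{m-1}\colon\mathbb{R}\to\mathbb{C}$ and a constant $c\in\mathbb{C}$ with the following properties. (1) For integers $N\to\infty$, $$\sum_{1\le n<N}n^\kappa\sum_{\substack{j+k=m-1\\0\le j<m}}\frac{(\log n)^k}{k!}\Phi_j(\log_q n) = c+N^{\kappa+1}\sum_{\substack{j+k=m-1\\-1\le j<m}}\frac{(\log N)^k}{k!}\Psi_j(\log_q N)+O\bigl(N^{\Re\kappa+1-\beta}\bigr).$$ (2) Let $\varphi_{j\ell}=\int_0^1\Phi_j(u)\exp(-2\ell\pi iu)\,\mathrm{d}u$ and $\psi_{j\ell}=\int_0^1\Psi_j(u)\exp(-2\ell\pi iu)\,\mathrm{d}u$ denote the Fourier coefficients. Then, for every $\ell\in\mathbb{Z}$, $$\sum_{0\le j<m}\varphi_{j\ell}Z^j=\Bigl(\kappa+1+\frac{2\ell\pi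 i}{\log q}+Z\Bigr)\sum_{-1\le j<m}\psi_{j\ell}Z^j+O(Z^m)\qquad(Z\to0,\ Z\ne 0).$$ (3) If $q^{\kappa+1}\neq1$, then $\Psi_{-1}$ vanishes identically. -/

import Mathlib

open Filter Topology Asymptotics
open scoped NNReal Nat

/-- The `ℓ`-th Fourier coefficient `∫₀¹ f(u) exp(-2ℓπiu) du` of a function of period `1`. -/
noncomputable def periodicFourierCoeff (f : ℝ → ℂ) (ℓ : ℤ) : ℂ :=
  ∫ u in (0 : ℝ)..1, f u * Complex.exp (-2 * (ℓ : ℂ) * (Real.pi : ℂ) * Complex.I * (u : ℂ))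

/-!
In the variable `t = log x`, the function `x ^ (κ + 1) * ∑ (log x) ^ k / k! * Ψ_j (log_q x)` is an
antiderivative of the summand as soon as the rescaled `Ψ_j` solve a triangular system of linear
equations `Ψ_j' = Φ_j - Ψ_{j-1} - (κ + 1) Ψ_j` with periodic forcing terms. The only obstruction
to periodic solutions is the resonance `exp ((κ + 1) log q) = q ^ (κ + 1) = 1`. There the solution
of each equation is free up to a multiple of `exp (-(κ + 1) t)`, which is chosen so as to make the
next equation solvable; this requires starting with a homogeneous equation for `Ψ_{-1}`, whose
only periodic solution is `0` if there is no resonance.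

Hölder continuity of the `Φ_j` makes the summand vary slowly on unit intervals, so that its sum
and its antiderivative differ by a constant up to `O(N ^ (Re κ + 1 - β))`. The relation between
the Fourier coefficients is the Fourier transform of the system of equations.
-/

section PeriodicODE

variable {E : Type*} [NormedAddCommGroup E] [NormedSpace ℂ E]
  {T : ℝ} {s ω : ℂ} {f g y : ℝ → E}

/-- The Laplace transform `∫₀ᵀ exp(-ωt) f(t) dt` over one period. For `exp(ωT) = 1` it is `T` times
a Fourier coefficient of the `T`-periodic function `f`. -/
noncomputable def finiteLaplace (T : ℝ) (ω : ℂ) (f : ℝ → E) : E :=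
  ∫ t in (0 : ℝ)..T, Complex.exp (-ω * t) • f t

theorem finiteLaplace_zero_right : finiteLaplace T ω (0 : ℝ → E) = 0 := by
  simp [finiteLaplace]

theorem finiteLaplace_sub (hf : Continuous f) (hg : Continuous g) :
    finiteLaplace T ω (f - g) = finiteLaplace T ω f - finiteLaplace T ω g := by
  simp only [finiteLaplace, Pi.sub_apply, smul_sub]
  exact intervalIntegral.integral_sub (Continuous.intervalIntegrable (by fun_prop) _ _)
    (Continuous.intervalIntegrable (by fun_prop) _ _)

theorem finiteLaplace_const_smul (c : ℂ) (f : ℝ → E) :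
    finiteLaplace T ω (c • f) = c • finiteLaplace T ω f := by
  simp only [finiteLaplace, Pi.smul_apply, smul_comm _ c, intervalIntegral.integral_smul]

theorem finiteLaplace_cexp_smul [CompleteSpace E] (T : ℝ) (ω : ℂ) (C : E) :
    finiteLaplace T ω (fun t => Complex.exp (ω * t) • C) = (T : ℂ) • C := by
  simp [finiteLaplace, smul_smul, ← Complex.exp_add]

theorem finiteLaplace_add_of_periodic (hg : Continuous g) (hgT : Function.Periodic g T)
    (ω : ℂ) (t : ℝ) :
    finiteLaplace (t + T) ω g =
      finiteLaplace T ω g + Complex.exp (-ω * T) • finiteLaplace t ω g := by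
  have hint : ∀ a b : ℝ, IntervalIntegrable (fun t : ℝ => Complex.exp (-ω * t) • g t)
      MeasureTheory.volume a b := fun a b => Continuous.intervalIntegrable (by fun_prop) a b
  have hshift : ∫ τ in T..(t + T), Complex.exp (-ω * τ) • g τ =
      Complex.exp (-ω * T) • finiteLaplace t ω g :=
    calc ∫ τ in T..(t + T), Complex.exp (-ω * τ) • g τ
        = ∫ τ in (0 : ℝ)..t, Complex.exp (-ω * ↑(τ + T)) • g (τ + T) := by
          rw [intervalIntegral.integral_comp_add_right (fun τ : ℝ => Complex.exp (-ω * τ) • g τ),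
            zero_add]
      _ = ∫ τ in (0 : ℝ)..t, Complex.exp (-ω * T) • Complex.exp (-ω * τ) • g τ := by
          simp only [hgT _, smul_smul, ← Complex.exp_add, Complex.ofReal_add, mul_add,
            add_comm (-ω * (T : ℂ))]
      _ = _ := intervalIntegral.integral_smul _ _
  rw [← hshift]
  exact (intervalIntegral.integral_add_adjacent_intervals (hint 0 T) (hint T _)).symm

theorem hasDerivAt_finiteLaplace [CompleteSpace E] (hg : Continuous g) (ω : ℂ) (t : ℝ) :
    HasDerivAt (fun t => finiteLaplace t ω g) (Complex.exp (-ω * t) • g t) t :=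
  (Continuous.integral_hasStrictDerivAt (by fun_prop) 0 t).hasDerivAt

theorem hasDerivAt_cexp_mul (s : ℂ) (t : ℝ) :
    HasDerivAt (fun t : ℝ => Complex.exp (s * t)) (s * Complex.exp (s * t)) t := by
  have h : HasDerivAt (fun t : ℝ => s * (t : ℂ)) s t := by
    simpa using (Complex.ofRealCLM.hasDerivAt (x := t)).const_mul s
  exact h.cexp.congr_deriv (mul_comm _ _)

theorem hasDerivAt_cexp_smul_of_linear {t : ℝ} {x : E} (ω : ℂ)
    (hy : HasDerivAt y (x - s • y t) t) :
    HasDerivAt (fun t : ℝ => Complex.exp (ω * t) • y t)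
      (Complex.exp (ω * t) • x - (s - ω) • Complex.exp (ω * t) • y t) t :=
  ((hasDerivAt_cexp_mul ω t).smul hy).congr_deriv (by module)

theorem finiteLaplace_eq_smul_of_hasDerivAt [CompleteSpace E] (hω : Complex.exp (ω * T) = 1)
    (hg : Continuous g) (hyT : y T = y 0) (hy : ∀ t, HasDerivAt y (g t - s • y t) t) :
    finiteLaplace T ω g = (s + ω) • finiteLaplace T ω y := by
  have hyc : Continuous y := continuous_iff_continuousAt.2 fun t => (hy t).continuousAt
  have hderiv : ∀ t ∈ Set.uIcc 0 T, HasDerivAt (fun t : ℝ => Complex.exp (-ω * t) • y t)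
      (Complex.exp (-ω * t) • (g - (s + ω) • y) t) t := fun t _ =>
    (hasDerivAt_cexp_smul_of_linear (-ω) (hy t)).congr_deriv (by
      simp only [Pi.sub_apply, Pi.smul_apply]
      module)
  have hboundary : finiteLaplace T ω (g - (s + ω) • y) = 0 := by
    rw [finiteLaplace, intervalIntegral.integral_eq_sub_of_hasDerivAt hderiv
      (Continuous.intervalIntegrable (by fun_prop) _ _), hyT, neg_mul, Complex.exp_neg, hω]
    simp
  rwa [finiteLaplace_sub hg (hyc.const_smul _), finiteLaplace_const_smul, sub_eq_zero] at hboundary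

theorem eq_zero_of_periodic_of_hasDerivAt (hs : Complex.exp (s * T) ≠ 1)
    (hyT : Function.Periodic y T) (hy : ∀ t, HasDerivAt y (-(s • y t)) t) : y = 0 := by
  have hderiv : ∀ t, HasDerivAt (fun t : ℝ => Complex.exp (s * t) • y t) 0 t := fun t =>
    ((hasDerivAt_cexp_mul s t).smul (hy t)).congr_deriv (by module)
  have hconst : ∀ t, Complex.exp (s * ↑(t + T)) • y (t + T) = Complex.exp (s * t) • y t :=
    fun t => is_const_of_deriv_eq_zero (fun t => (hderiv t).differentiableAt)
      (fun t => (hderiv t).deriv) (t + T) t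
  funext t
  have hfix : (Complex.exp (s * T) - 1) • Complex.exp (s * t) • y t = 0 := by
    rw [sub_smul, one_smul, smul_smul, ← Complex.exp_add, sub_eq_zero, ← hconst t, hyT]
    congr 2
    push_cast
    ring
  simpa [sub_ne_zero.2 hs, Complex.exp_ne_zero] using hfix

/-- Variation of constants: the solution with initial value `C` is periodic as soon as it returns
to `C` after one period. -/
theorem exists_periodic_hasDerivAt_of_initialValue [CompleteSpace E] (hg : Continuous g)
    (hgT : Function.Periodic g T) (C : E)
    (hC : (Complex.exp (s * T) - 1) • C = finiteLaplace T (-s) g) :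
    ∃ y : ℝ → E, Function.Periodic y T ∧ ∀ t, HasDerivAt y (g t - s • y t) t := by
  have hcancel : ∀ t : ℝ, Complex.exp (-s * t) * Complex.exp (s * t) = 1 := fun t => by
    simp [← Complex.exp_add]
  refine ⟨fun t => Complex.exp (-s * t) • (C + finiteLaplace t (-s) g), fun t => ?_, fun t => ?_⟩
  · have hexp : Complex.exp (-s * ↑(t + T)) * Complex.exp (s * T) = Complex.exp (-s * t) := by
      rw [← Complex.exp_add]
      push_cast
      ring_nf
    have hreturn : C + finiteLaplace (t + T) (-s) g =
        Complex.exp (s * T) • (C + finiteLaplace t (-s) g) := by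
      rw [finiteLaplace_add_of_periodic hg hgT, ← hC, neg_neg]
      module
    simp only [hreturn, smul_smul, hexp]
  · refine ((hasDerivAt_cexp_mul (-s) t).smul
      ((hasDerivAt_finiteLaplace hg (-s) t).const_add C)).congr_deriv ?_
    rw [neg_neg, smul_smul, hcancel]
    module

/-- The Fredholm condition for the periodic problem `y' = g - s y`: in the resonant case
`exp(sT) = 1` the forcing term has no component along the homogeneous solution `exp(-st)`. -/
def PeriodicallySolvable (T : ℝ) (s : ℂ) (g : ℝ → E) : Prop :=
  Complex.exp (s * T) = 1 → finiteLaplace T (-s) g = 0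

theorem PeriodicallySolvable.exists_periodic_hasDerivAt [CompleteSpace E]
    (h : PeriodicallySolvable T s g) (hg : Continuous g) (hgT : Function.Periodic g T) :
    ∃ y : ℝ → E, Function.Periodic y T ∧ ∀ t, HasDerivAt y (g t - s • y t) t := by
  by_cases hs : Complex.exp (s * T) = 1
  · exact exists_periodic_hasDerivAt_of_initialValue hg hgT 0 (by rw [smul_zero, h hs])
  · exact exists_periodic_hasDerivAt_of_initialValue hg hgT _
      (smul_inv_smul₀ (sub_ne_zero.2 hs) (finiteLaplace T (-s) g))

/-- In the resonant case the periodic solution is unique only up to multiples of `exp(-st)`, and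
this freedom is spent on making `f - y` solvable in turn. -/
theorem PeriodicallySolvable.exists_periodic_hasDerivAt_sub [CompleteSpace E]
    (h : PeriodicallySolvable T s g) (hT : T ≠ 0) (hg : Continuous g)
    (hgT : Function.Periodic g T) (hf : Continuous f) :
    ∃ y : ℝ → E, Function.Periodic y T ∧ (∀ t, HasDerivAt y (g t - s • y t) t) ∧
      PeriodicallySolvable T s (f - y) := by
  obtain ⟨y, hyT, hy⟩ := h.exists_periodic_hasDerivAt hg hgT
  by_cases hs : Complex.exp (s * T) = 1
  · have hyc : Continuous y := continuous_iff_continuousAt.2 fun t => (hy t).continuousAt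
    let D := (T : ℂ)⁻¹ • finiteLaplace T (-s) (f - y)
    let z : ℝ → E := fun t => Complex.exp (-s * t) • D
    have hz : ∀ t, HasDerivAt z (-(s • z t)) t := fun t =>
      ((hasDerivAt_cexp_mul (-s) t).smul_const D).congr_deriv (by module)
    have hzT : Function.Periodic z T := fun t => by
      simp only [z, Complex.ofReal_add, mul_add, Complex.exp_add, neg_mul, Complex.exp_neg, hs,
        mul_one]
    have hzLaplace : finiteLaplace T (-s) z = finiteLaplace T (-s) (f - y) := by
      rw [finiteLaplace_cexp_smul, smul_inv_smul₀ (Complex.ofReal_ne_zero.2 hT)]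
    refine ⟨y + z, hyT.add hzT, fun t => ?_, fun _ => ?_⟩
    · refine ((hy t).add (hz t)).congr_deriv ?_
      simp only [Pi.add_apply]
      module
    · rw [← sub_sub, finiteLaplace_sub (hf.sub hyc) (by fun_prop), hzLaplace, sub_self]
  · exact ⟨y, hyT, hy, fun hres => absurd hres hs⟩

/-- The right-hand sides `0, f 0 - χ 0, f 1 - χ 1, …` of the triangular system
`χ' n = chainSource f χ n - s χ n`. -/
def chainSource (f χ : ℕ → ℝ → E) : ℕ → ℝ → E
  | 0 => 0
  | n + 1 => f n - χ n

/-- The functions `χ n` are the `T`-periodic solutions of the triangular system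
`χ₀' = -s χ₀`, `χₙ₊₁' = fₙ - χₙ - s χₙ₊₁`. For `T = log q` and `s = κ + 1`, the function `Ψⱼ` of
the theorem is `u ↦ χ (j + 1) (T u)`, so indices are shifted by one. -/
structure IsPeriodicChain (T : ℝ) (s : ℂ) (f χ : ℕ → ℝ → E) : Prop where
  periodic : ∀ n, Function.Periodic (χ n) T
  hasDerivAt : ∀ n t, HasDerivAt (χ n) (chainSource f χ n t - s • χ n t) t

theorem exists_isPeriodicChain [CompleteSpace E] (hT : T ≠ 0) (s : ℂ) {f : ℕ → ℝ → E}
    (hf : ∀ n, Continuous (f n)) (hfT : ∀ n, Function.Periodic (f n) T) :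
    ∃ χ : ℕ → ℝ → E, IsPeriodicChain T s f χ := by
  let Extendable : ℕ → Type _ := fun n => {y : ℝ → E //
    Continuous y ∧ Function.Periodic y T ∧ PeriodicallySolvable T s (f n - y)}
  have solve : ∀ n (g : ℝ → E), Continuous g → Function.Periodic g T →
      PeriodicallySolvable T s g →
      ∃ y : Extendable n, ∀ t, HasDerivAt y.1 (g t - s • y.1 t) t := fun n g hg hgT h => by
    obtain ⟨y, hyT, hy, hsol⟩ := h.exists_periodic_hasDerivAt_sub hT hg hgT (hf n)
    exact ⟨⟨y, continuous_iff_continuousAt.2 fun t => (hy t).continuousAt, hyT, hsol⟩, hy⟩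
  obtain ⟨y₀, hy₀⟩ := solve 0 0 continuous_zero (fun _ => rfl) fun _ => finiteLaplace_zero_right
  choose next hnext using fun n (y : Extendable n) =>
    solve (n + 1) (f n - y.1) ((hf n).sub y.2.1) ((hfT n).sub y.2.2.1) y.2.2.2
  let χ : ∀ n, Extendable n := fun n => Nat.rec y₀ next n
  refine ⟨fun n => (χ n).1, fun n => (χ n).2.2.1, ?_⟩
  rintro (_ | n)
  · exact hy₀
  · exact hnext n (χ n)

theorem exists_isPeriodicChain_rescale [CompleteSpace E] (hT : T ≠ 0) (s : ℂ) {m : ℕ}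
    {Φ : ℕ → ℝ → E} (hΦ : ∀ j < m, Continuous (Φ j))
    (hΦper : ∀ j < m, Function.Periodic (Φ j) 1) :
    ∃ f χ : ℕ → ℝ → E, IsPeriodicChain T s f χ ∧ (∀ n, Continuous (f n)) ∧
      ∀ j < m, ∀ u, f j (T * u) = Φ j u := by
  let f : ℕ → ℝ → E := fun j t => if j < m then Φ j (t / T) else 0
  have hf : ∀ j, Continuous (f j) ∧ Function.Periodic (f j) T := fun j => by
    by_cases hj : j < m
    · simp only [f, hj, if_true]
      exact ⟨(hΦ j hj).comp (continuous_id.div_const T), by simpa using (hΦper j hj).div_const T⟩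
    · simp only [f, hj, if_false]
      exact ⟨continuous_const, fun _ => rfl⟩
  obtain ⟨χ, hχ⟩ := exists_isPeriodicChain hT s (fun j => (hf j).1) fun j => (hf j).2
  refine ⟨f, χ, hχ, fun j => (hf j).1, fun j hj u => ?_⟩
  simp only [f, hj, if_true, mul_div_cancel_left₀ u hT]

namespace IsPeriodicChain

variable {f χ : ℕ → ℝ → E}

theorem continuous (h : IsPeriodicChain T s f χ) (n : ℕ) : Continuous (χ n) :=
  continuous_iff_continuousAt.2 fun t => (h.hasDerivAt n t).continuousAt

theorem continuous_chainSource (h : IsPeriodicChain T s f χ) (hf : ∀ n, Continuous (f n)) (n : ℕ) :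
    Continuous (chainSource f χ n) := by
  cases n with
  | zero => exact continuous_zero
  | succ n => exact (hf n).sub (h.continuous n)

theorem contDiff_one (h : IsPeriodicChain T s f χ) (hf : ∀ n, Continuous (f n)) (n : ℕ) :
    ContDiff ℝ 1 (χ n) := by
  refine contDiff_one_iff_deriv.2 ⟨fun t => (h.hasDerivAt n t).differentiableAt, ?_⟩
  rw [show deriv (χ n) = _ from funext fun t => (h.hasDerivAt n t).deriv]
  exact (h.continuous_chainSource hf n).sub ((h.continuous n).const_smul s)

theorem zero_eq_zero (h : IsPeriodicChain T s f χ) (hs : Complex.exp (s * T) ≠ 1) : χ 0 = 0 :=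
  eq_zero_of_periodic_of_hasDerivAt hs (h.periodic 0) fun t => by
    simpa [chainSource] using h.hasDerivAt 0 t

end IsPeriodicChain

end PeriodicODE

section FourierCoefficients

variable {E : Type*} [NormedAddCommGroup E] [NormedSpace ℂ E] {T : ℝ} {s : ℂ}
  {f χ : ℕ → ℝ → E}

theorem fourierCoeffOn_comp_mul_left (hT : T ≠ 0) (f : ℝ → E) (ℓ : ℤ) :
    fourierCoeffOn (zero_lt_one' ℝ) (fun u => f (T * u)) ℓ =
      (T : ℂ)⁻¹ • finiteLaplace T (2 * ℓ * Real.pi * Complex.I / T) f := by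
  have hexp : ∀ u : ℝ, fourier (-ℓ) (u : AddCircle (1 - 0 : ℝ)) =
      Complex.exp (-(2 * ℓ * Real.pi * Complex.I / T) * ↑(T * u)) := fun u => by
    rw [fourier_coe_apply]
    congr 1
    push_cast
    field [Complex.ofReal_ne_zero.2 hT]
  have hsubst := intervalIntegral.integral_comp_mul_left (a := 0) (b := 1)
    (fun t : ℝ => Complex.exp (-(2 * ℓ * Real.pi * Complex.I / T) * t) • f t) hT
  rw [fourierCoeffOn_eq_integral]
  simp only [hexp, sub_zero, div_one, one_smul]
  rw [hsubst, mul_zero, mul_one, finiteLaplace, ← Complex.ofReal_inv, Complex.coe_smul]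

theorem periodicFourierCoeff_eq_fourierCoeffOn (f : ℝ → ℂ) (ℓ : ℤ) :
    periodicFourierCoeff f ℓ = fourierCoeffOn (zero_lt_one' ℝ) f ℓ := by
  rw [periodicFourierCoeff, fourierCoeffOn_eq_integral]
  simp only [sub_zero, div_one, one_smul, smul_eq_mul, fourier_coe_apply, Complex.ofReal_one]
  congr! 2 with u
  rw [mul_comm]
  congr 2
  push_cast
  ring

theorem sum_Ico_neg_one {M : Type*} [AddCommMonoid M] (m : ℕ) (g : ℤ → M) :
    ∑ j ∈ Finset.Ico (-1 : ℤ) m, g j = ∑ i ∈ Finset.range (m + 1), g ((i : ℤ) - 1) := by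
  refine (Finset.sum_bij (fun (i : ℕ) _ => (i : ℤ) - 1) ?_ ?_ ?_ fun _ _ => rfl).symm
  · intro i hi
    simp only [Finset.mem_range, Finset.mem_Ico] at hi ⊢
    omega
  · intro i _ j _ h
    omega
  · intro j hj
    simp only [Finset.mem_Ico] at hj
    exact ⟨(j + 1).toNat, by simp only [Finset.mem_range]; omega, by omega⟩

theorem sum_pow_smul_sub_smul_sum_zpow_smul {K V : Type*} [Field K] [AddCommGroup V] [Module K V]
    {A Z : K} (hZ : Z ≠ 0) {w ψ : ℕ → V} (h_zero : A • ψ 0 = 0)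
    (h_succ : ∀ j, A • ψ (j + 1) = w j - ψ j) (m : ℕ) :
    ∑ j ∈ Finset.range m, Z ^ j • w j -
      (A + Z) • ∑ i ∈ Finset.range (m + 1), Z ^ ((i : ℤ) - 1) • ψ i = -(Z ^ m • ψ m) := by
  induction m with
  | zero =>
    have hA : A • Z⁻¹ • ψ 0 = 0 := by rw [smul_comm, h_zero, smul_zero]
    simp [add_smul, hA, hZ]
  | succ m ih =>
    have hexponent : Z ^ (((m + 1 : ℕ) : ℤ) - 1) = Z ^ m := by simp
    have hw : w m = A • ψ (m + 1) + ψ m := by rw [h_succ, sub_add_cancel]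
    rw [Finset.sum_range_succ, Finset.sum_range_succ (fun i : ℕ => Z ^ ((i : ℤ) - 1) • ψ i),
      hexponent, smul_add, add_sub_add_comm, ih, hw]
    module

namespace IsPeriodicChain

theorem smul_fourierCoeffOn [CompleteSpace E] (h : IsPeriodicChain T s f χ) (hT : T ≠ 0)
    (hf : ∀ n, Continuous (f n)) (n : ℕ) (ℓ : ℤ) :
    (s + 2 * ℓ * Real.pi * Complex.I / T) •
        fourierCoeffOn (zero_lt_one' ℝ) (fun u => χ n (T * u)) ℓ =
      fourierCoeffOn (zero_lt_one' ℝ) (fun u => chainSource f χ n (T * u)) ℓ := by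
  have hω : Complex.exp (2 * ℓ * Real.pi * Complex.I / T * T) = 1 := by
    rw [div_mul_cancel₀ _ (Complex.ofReal_ne_zero.2 hT), ← Complex.exp_int_mul_two_pi_mul_I ℓ]
    ring_nf
  rw [fourierCoeffOn_comp_mul_left hT, fourierCoeffOn_comp_mul_left hT, smul_comm,
    ← finiteLaplace_eq_smul_of_hasDerivAt hω (h.continuous_chainSource hf n)
      (by simpa using h.periodic n 0) (h.hasDerivAt n)]

theorem isBigO_sum_fourierCoeffOn [CompleteSpace E] (h : IsPeriodicChain T s f χ) (hT : T ≠ 0)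
    (hf : ∀ n, Continuous (f n)) (m : ℕ) (ℓ : ℤ) :
    (fun Z : ℂ =>
      ∑ j ∈ Finset.range m, Z ^ j • fourierCoeffOn (zero_lt_one' ℝ) (fun u => f j (T * u)) ℓ -
        (s + 2 * ℓ * Real.pi * Complex.I / T + Z) • ∑ j ∈ Finset.Ico (-1 : ℤ) m,
          Z ^ j • fourierCoeffOn (zero_lt_one' ℝ) (fun u => χ (j + 1).toNat (T * u)) ℓ)
      =O[𝓝[≠] 0] fun Z : ℂ => Z ^ m := by
  let ψ : ℕ → E := fun n => fourierCoeffOn (zero_lt_one' ℝ) (fun u => χ n (T * u)) ℓ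
  have h_zero : (s + 2 * ℓ * Real.pi * Complex.I / T) • ψ 0 = 0 := by
    rw [h.smul_fourierCoeffOn hT hf, fourierCoeffOn_comp_mul_left hT, chainSource,
      finiteLaplace_zero_right, smul_zero]
  have h_succ : ∀ j, (s + 2 * ℓ * Real.pi * Complex.I / T) • ψ (j + 1) =
      fourierCoeffOn (zero_lt_one' ℝ) (fun u => f j (T * u)) ℓ - ψ j := fun j => by
    rw [h.smul_fourierCoeffOn hT hf, fourierCoeffOn_comp_mul_left hT, chainSource,
      finiteLaplace_sub (hf j) (h.continuous j), smul_sub, ← fourierCoeffOn_comp_mul_left hT,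
      ← fourierCoeffOn_comp_mul_left hT]
  refine IsBigO.of_bound ‖ψ m‖ (eventually_mem_nhdsWithin.mono fun Z hZ => le_of_eq ?_)
  simp only [sum_Ico_neg_one, sub_add_cancel, Int.toNat_natCast]
  rw [sum_pow_smul_sub_smul_sum_zpow_smul hZ h_zero h_succ, norm_neg, norm_smul, mul_comm]

end IsPeriodicChain

end FourierCoefficients

section LogPolynomial

variable {E : Type*} [NormedAddCommGroup E] [NormedSpace ℂ E] {T t : ℝ} {s : ℂ}
  {f f' χ : ℕ → ℝ → E}

/-- The polynomial `∑_{j + k = m} tᵏ / k! · f j t` in `t` with coefficients depending on `t`. It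
occurs at `t = log n`, with periodic coefficients. -/
noncomputable def logPolynomial (m : ℕ) (f : ℕ → ℝ → E) (t : ℝ) : E :=
  ∑ p ∈ Finset.HasAntidiagonal.antidiagonal m, ((t : ℂ) ^ p.2 / (p.2 ! : ℂ)) • f p.1 t

theorem logPolynomial_sub (m : ℕ) (f g : ℕ → ℝ → E) :
    logPolynomial m (f - g) = logPolynomial m f - logPolynomial m g := by
  ext t
  simp only [logPolynomial, Pi.sub_apply, smul_sub, Finset.sum_sub_distrib]

theorem logPolynomial_const_smul (m : ℕ) (c : ℂ) (f : ℕ → ℝ → E) :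
    logPolynomial m (c • f) = c • logPolynomial m f := by
  ext t
  simp only [logPolynomial, Pi.smul_apply, smul_comm _ c, Finset.smul_sum]

theorem logPolynomial_succ_chainSource (m : ℕ) (f χ : ℕ → ℝ → E) :
    logPolynomial (m + 1) (chainSource f χ) = logPolynomial m (f - χ) := by
  ext t
  simp [logPolynomial, Finset.Nat.sum_antidiagonal_succ, chainSource]

theorem hasDerivAt_ofReal_pow_div_factorial (k : ℕ) (t : ℝ) :
    HasDerivAt (fun t : ℝ => (t : ℂ) ^ (k + 1) / ((k + 1) ! : ℂ)) ((t : ℂ) ^ k / (k ! : ℂ)) t := by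
  have h : HasDerivAt (fun t : ℝ => (t : ℂ)) 1 t := (hasDerivAt_id t).ofReal_comp
  refine ((h.pow (k + 1)).div_const _).congr_deriv ?_
  rw [Nat.factorial_succ, Nat.add_sub_cancel, mul_one, Nat.cast_mul]
  exact mul_div_mul_left _ _ (by exact_mod_cast k.succ_ne_zero)

theorem hasDerivAt_logPolynomial_succ (m : ℕ) (hf : ∀ n, HasDerivAt (f n) (f' n t) t) :
    HasDerivAt (logPolynomial (m + 1) f) (logPolynomial (m + 1) f' t + logPolynomial m f t) t := by
  let d : ℕ → ℂ := fun k => Nat.casesOn k 0 fun k => (t : ℂ) ^ k / (k ! : ℂ)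
  have hd : ∀ k, HasDerivAt (fun t : ℝ => (t : ℂ) ^ k / (k ! : ℂ)) (d k) t := by
    rintro (_ | k)
    · simpa [d] using hasDerivAt_const t (1 : ℂ)
    · exact hasDerivAt_ofReal_pow_div_factorial k t
  refine (HasDerivAt.fun_sum fun p _ => (hd p.2).smul (hf p.1)).congr_deriv ?_
  rw [Finset.sum_add_distrib, Finset.Nat.sum_antidiagonal_succ' (f := fun p => d p.2 • f p.1 t)]
  simp [d, logPolynomial]

theorem IsPeriodicChain.hasDerivAt_logPolynomial (h : IsPeriodicChain T s f χ) (m : ℕ) (t : ℝ) :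
    HasDerivAt (logPolynomial (m + 1) χ) (logPolynomial m f t - s • logPolynomial (m + 1) χ t) t :=
  (hasDerivAt_logPolynomial_succ (f' := chainSource f χ - s • χ) m
    fun n => h.hasDerivAt n t).congr_deriv (by
      rw [logPolynomial_sub, logPolynomial_const_smul, logPolynomial_succ_chainSource,
        logPolynomial_sub]
      simp only [Pi.sub_apply, Pi.smul_apply]
      abel)

theorem hasDerivAt_ofReal_cpow_of_pos (s : ℂ) {x : ℝ} (hx : 0 < x) :
    HasDerivAt (fun x : ℝ => (x : ℂ) ^ s) (s * (x : ℂ) ^ (s - 1)) x :=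
  (hasDerivAt_id (x : ℂ)).cpow_const (Complex.ofReal_mem_slitPlane.2 hx)
    |>.comp_ofReal.congr_deriv (mul_one _)

theorem IsPeriodicChain.hasDerivAt_cpow_smul_logPolynomial (h : IsPeriodicChain T s f χ) (m : ℕ)
    {x : ℝ} (hx : 0 < x) :
    HasDerivAt (fun x : ℝ => (x : ℂ) ^ s • logPolynomial (m + 1) χ (Real.log x))
      ((x : ℂ) ^ (s - 1) • logPolynomial m f (Real.log x)) x := by
  have hx0 : (x : ℂ) ≠ 0 := Complex.ofReal_ne_zero.2 hx.ne'
  have hcpow : (x : ℂ) ^ s = (x : ℂ) ^ (s - 1) * x := by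
    rw [Complex.cpow_sub _ _ hx0, Complex.cpow_one, div_mul_cancel₀ _ hx0]
  have hlog :=
    (h.hasDerivAt_logPolynomial m (Real.log x)).scomp x (Real.hasDerivAt_log hx.ne')
  refine ((hasDerivAt_ofReal_cpow_of_pos s hx).smul hlog).congr_deriv ?_
  rw [Function.comp_apply, ← Complex.coe_smul, smul_smul, hcpow, Complex.ofReal_inv,
    mul_inv_cancel_right₀ hx0]
  module

end LogPolynomial

section SlowlyIncreasing

variable {E : Type*} [NormedAddCommGroup E] {α β r s ε : ℝ} {f g : ℝ → E}

/-- Growth of order `t ^ r` at infinity, with increments of order `t ^ (r - α)` over intervals of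
length at most `1`. -/
def SlowlyIncreasing (α r : ℝ) (f : ℝ → E) : Prop :=
  ∃ K : ℝ, 0 ≤ K ∧ ∀ t x : ℝ, 1 ≤ t → t ≤ x → x ≤ t + 1 →
    ‖f t‖ ≤ K * t ^ r ∧ ‖f x - f t‖ ≤ K * t ^ (r - α)

theorem rpow_le_two_rpow_abs_mul_rpow {x y : ℝ} (hx : 0 < x) (hy : 0 < y) (hxy : x ≤ 2 * y)
    (hyx : y ≤ 2 * x) (r : ℝ) : x ^ r ≤ 2 ^ |r| * y ^ r := by
  rcases le_total 0 r with hr | hr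
  · rw [abs_of_nonneg hr, ← Real.mul_rpow zero_le_two hy.le]
    exact Real.rpow_le_rpow hx.le hxy hr
  · rw [abs_of_nonpos hr, Real.rpow_neg zero_le_two, inv_mul_eq_div, le_div_iff₀' (by positivity),
      ← Real.mul_rpow zero_le_two hx.le]
    exact Real.rpow_le_rpow_of_nonpos hy hyx hr

theorem log_sub_log_le_inv {t x : ℝ} (ht : 0 < t) (htx : t ≤ x) (hxt : x ≤ t + 1) :
    Real.log x - Real.log t ≤ t⁻¹ := by
  have hx : 0 < x := ht.trans_le htx
  calc Real.log x - Real.log t = Real.log (x / t) := (Real.log_div hx.ne' ht.ne').symm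
    _ ≤ x / t - 1 := Real.log_le_sub_one_of_pos (by positivity)
    _ = (x - t) / t := by rw [sub_div, div_self ht.ne']
    _ ≤ t⁻¹ := by
      rw [← one_div]
      gcongr
      linarith

namespace SlowlyIncreasing

theorem mono (hf : SlowlyIncreasing α r f) (hrs : r ≤ s) : SlowlyIncreasing α s f := by
  obtain ⟨K, hK, h⟩ := hf
  refine ⟨K, hK, fun t x ht htx hxt => ⟨(h t x ht htx hxt).1.trans ?_,
    (h t x ht htx hxt).2.trans ?_⟩⟩ <;> gcongr

theorem anti (hf : SlowlyIncreasing α r f) (hβα : β ≤ α) : SlowlyIncreasing β r f := by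
  obtain ⟨K, hK, h⟩ := hf
  refine ⟨K, hK, fun t x ht htx hxt => ⟨(h t x ht htx hxt).1, (h t x ht htx hxt).2.trans ?_⟩⟩
  gcongr

theorem zero : SlowlyIncreasing α r (fun _ => (0 : E)) :=
  ⟨0, le_rfl, by simp⟩

theorem const (c : E) : SlowlyIncreasing α 0 (fun _ => c) :=
  ⟨‖c‖, norm_nonneg c, fun t _ _ _ _ => ⟨by simp, by
    rw [sub_self, norm_zero]
    positivity⟩⟩

theorem add (hf : SlowlyIncreasing α r f) (hg : SlowlyIncreasing α r g) :
    SlowlyIncreasing α r (fun x => f x + g x) := by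
  obtain ⟨K, hK, hf⟩ := hf
  obtain ⟨M, hM, hg⟩ := hg
  refine ⟨K + M, by positivity, fun t x ht htx hxt => ⟨?_, ?_⟩⟩
  · rw [add_mul]
    exact norm_add_le_of_le (hf t x ht htx hxt).1 (hg t x ht htx hxt).1
  · rw [add_mul, add_sub_add_comm]
    exact norm_add_le_of_le (hf t x ht htx hxt).2 (hg t x ht htx hxt).2

theorem sum {ι : Type*} (S : Finset ι) {F : ι → ℝ → E}
    (h : ∀ i ∈ S, SlowlyIncreasing α r (F i)) :
    SlowlyIncreasing α r (fun x => ∑ i ∈ S, F i x) := by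
  classical
  induction S using Finset.induction_on with
  | empty => exact zero
  | insert i S hi ih =>
    simp only [Finset.sum_insert hi]
    exact (h i (Finset.mem_insert_self i S)).add
      (ih fun j hj => h j (Finset.mem_insert_of_mem hj))

theorem smul {𝕜 : Type*} [NormedField 𝕜] [NormedSpace 𝕜 E] {c : ℝ → 𝕜} (hα : 0 ≤ α)
    (hc : SlowlyIncreasing α r c) (hf : SlowlyIncreasing α s f) :
    SlowlyIncreasing α (r + s) (fun x => c x • f x) := by
  obtain ⟨K, hK, hc⟩ := hc
  obtain ⟨M, hM, hf⟩ := hf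
  refine ⟨3 * (K * M), by positivity, fun t x ht htx hxt => ?_⟩
  have ht0 : 0 < t := one_pos.trans_le ht
  have hsmul {a : 𝕜} {b : E} {A B : ℝ} (ha : ‖a‖ ≤ A) (hb : ‖b‖ ≤ B) : ‖a • b‖ ≤ A * B :=
    (norm_smul a b).trans_le (mul_le_mul ha hb (norm_nonneg b) ((norm_nonneg a).trans ha))
  obtain ⟨hct, hcx⟩ := hc t x ht htx hxt
  obtain ⟨hft, hfx⟩ := hf t x ht htx hxt
  constructor
  · calc ‖c t • f t‖ ≤ (K * t ^ r) * (M * t ^ s) := hsmul hct hft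
      _ = K * M * t ^ (r + s) := by
        rw [Real.rpow_add ht0]
        ring
      _ ≤ 3 * (K * M) * t ^ (r + s) :=
        mul_le_mul_of_nonneg_right (by linarith [mul_nonneg hK hM]) (by positivity)
  · have hft' : ‖f x - f t‖ ≤ M * t ^ s := hfx.trans (by gcongr; linarith)
    calc ‖c x • f x - c t • f t‖
        = ‖c t • (f x - f t) + (c x - c t) • f t + (c x - c t) • (f x - f t)‖ := by
          congr 1
          module
      _ ≤ (K * t ^ r) * (M * t ^ (s - α)) + (K * t ^ (r - α)) * (M * t ^ s) +
          (K * t ^ (r - α)) * (M * t ^ s) :=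
        norm_add_le_of_le (norm_add_le_of_le (hsmul hct hfx) (hsmul hcx hft)) (hsmul hcx hft')
      _ = 3 * (K * M) * t ^ (r + s - α) := by
        rw [add_sub_assoc, Real.rpow_add ht0, Real.rpow_sub ht0, Real.rpow_sub ht0]
        ring

theorem of_hasDerivAt [NormedSpace ℝ E] {f' : ℝ → E} {K M : ℝ}
    (hderiv : ∀ x, 1 ≤ x → HasDerivAt f (f' x) x) (hf : ∀ x, 1 ≤ x → ‖f x‖ ≤ K * x ^ r)
    (hf' : ∀ x, 1 ≤ x → ‖f' x‖ ≤ M * x ^ (r - 1)) : SlowlyIncreasing 1 r f := by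
  have hK : 0 ≤ K := by simpa using (norm_nonneg _).trans (hf 1 le_rfl)
  have hM : 0 ≤ M := by simpa using (norm_nonneg _).trans (hf' 1 le_rfl)
  have hMr : 0 ≤ M * 2 ^ |r - 1| := by positivity
  refine ⟨K + M * 2 ^ |r - 1|, by positivity, fun t x ht htx hxt => ⟨?_, ?_⟩⟩
  · refine (hf t ht).trans ?_
    gcongr
    linarith
  · have hbound : ∀ y ∈ Set.Ico t x, ‖f' y‖ ≤ M * 2 ^ |r - 1| * t ^ (r - 1) := fun y hy => by
      rw [mul_assoc]
      refine (hf' y (ht.trans hy.1)).trans ?_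
      gcongr
      exact rpow_le_two_rpow_abs_mul_rpow (by linarith [hy.1]) (by linarith) (by linarith [hy.2])
        (by linarith [hy.1]) _
    calc ‖f x - f t‖ ≤ M * 2 ^ |r - 1| * t ^ (r - 1) * (x - t) :=
          norm_image_sub_le_of_norm_deriv_le_segment'
            (fun y hy => (hderiv y (ht.trans hy.1)).hasDerivWithinAt) hbound x ⟨htx, le_rfl⟩
      _ ≤ M * 2 ^ |r - 1| * t ^ (r - 1) := mul_le_of_le_one_right (by positivity) (by linarith)
      _ ≤ (K + M * 2 ^ |r - 1|) * t ^ (r - 1) := by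
        gcongr
        linarith

end SlowlyIncreasing

theorem slowlyIncreasing_ofReal_cpow (s : ℂ) :
    SlowlyIncreasing 1 s.re (fun x : ℝ => (x : ℂ) ^ s) := by
  have hnorm : ∀ (c : ℂ) (x : ℝ), 1 ≤ x → ‖(x : ℂ) ^ c‖ = x ^ c.re := fun c x hx =>
    Complex.norm_cpow_eq_rpow_re_of_pos (one_pos.trans_le hx) c
  refine .of_hasDerivAt (K := 1) (M := ‖s‖)
    (fun x hx => hasDerivAt_ofReal_cpow_of_pos s (one_pos.trans_le hx)) (fun x hx => ?_)
    fun x hx => ?_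
  · rw [hnorm s x hx, one_mul]
  · rw [norm_mul, hnorm _ x hx, Complex.sub_re, Complex.one_re]

theorem slowlyIncreasing_log (hε : 0 < ε) :
    SlowlyIncreasing 1 ε (fun x => ((Real.log x : ℝ) : ℂ)) := by
  refine .of_hasDerivAt (K := ε⁻¹) (M := 1)
    (fun x hx => (Real.hasDerivAt_log (by positivity)).ofReal_comp) (fun x hx => ?_) fun x hx => ?_
  · rw [Complex.norm_of_nonneg (Real.log_nonneg hx), inv_mul_eq_div]
    exact Real.log_le_rpow_div (by positivity) hε
  · rw [Complex.norm_of_nonneg (by positivity), one_mul, ← Real.rpow_neg_one]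
    gcongr
    linarith

theorem slowlyIncreasing_log_pow (k : ℕ) (hε : 0 < ε) :
    SlowlyIncreasing 1 ε (fun x => ((Real.log x : ℝ) : ℂ) ^ k) := by
  induction k generalizing ε with
  | zero => simpa using (SlowlyIncreasing.const (1 : ℂ)).mono hε.le
  | succ k ih =>
    simpa only [pow_succ, smul_eq_mul, add_halves] using
      (ih (half_pos hε)).smul zero_le_one (slowlyIncreasing_log (half_pos hε))

theorem slowlyIncreasing_comp_log {C α : ℝ≥0} (hf : HolderWith C α f)
    (hbdd : Bornology.IsBounded (Set.range f)) :
    SlowlyIncreasing α 0 (fun x => f (Real.log x)) := by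
  obtain ⟨M, hM⟩ := hbdd.exists_norm_le
  have hM0 : 0 ≤ M := (norm_nonneg _).trans (hM (f 0) ⟨0, rfl⟩)
  refine ⟨M + C, by positivity, fun t x ht htx hxt => ⟨?_, ?_⟩⟩
  · rw [Real.rpow_zero, mul_one]
    exact (hM _ ⟨_, rfl⟩).trans (le_add_of_nonneg_right C.2)
  · have ht0 : 0 < t := one_pos.trans_le ht
    have hdist : dist (Real.log x) (Real.log t) ≤ t⁻¹ := by
      rw [Real.dist_eq, abs_of_nonneg (sub_nonneg.2 (Real.log_le_log ht0 htx))]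
      exact log_sub_log_le_inv ht0 htx hxt
    calc ‖f (Real.log x) - f (Real.log t)‖ ≤ C * t⁻¹ ^ (α : ℝ) := by
          rw [← dist_eq_norm]
          exact hf.dist_le_of_le hdist
      _ = C * t ^ (0 - (α : ℝ)) := by
        rw [Real.inv_rpow ht0.le, zero_sub, Real.rpow_neg ht0.le]
      _ ≤ (M + C) * t ^ (0 - (α : ℝ)) := by
        gcongr
        linarith

theorem slowlyIncreasing_comp_logb {C α : ℝ≥0} {f : ℝ → E} (hf : HolderWith C α f) (hα : 0 < α)
    (hper : Function.Periodic f 1) (q : ℝ) :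
    SlowlyIncreasing α 0 (fun x => f (Real.logb q x)) := by
  have hLip : LipschitzWith ‖(Real.log q)⁻¹‖₊ fun t : ℝ => t / Real.log q := by
    simpa only [div_eq_inv_mul, smul_eq_mul] using lipschitzWith_smul (β := ℝ) (Real.log q)⁻¹
  have hbdd : Bornology.IsBounded (Set.range fun t => f (t / Real.log q)) :=
    (hper.isBounded_of_continuous one_ne_zero (hf.continuous hα)).subset
      (Set.range_comp_subset_range _ f)
  have hcomp := hf.comp hLip.holderWith
  rw [mul_one] at hcomp
  exact slowlyIncreasing_comp_log hcomp hbdd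

theorem slowlyIncreasing_logPolynomial [NormedSpace ℂ E] {f : ℕ → ℝ → E} {m : ℕ} (hα : 0 ≤ α)
    (hα1 : α ≤ 1) (hf : ∀ j ≤ m, SlowlyIncreasing α 0 (fun x => f j (Real.log x))) (hε : 0 < ε) :
    SlowlyIncreasing α ε (fun x => logPolynomial m f (Real.log x)) := by
  refine .sum _ fun p hp => ?_
  have hcoeff : SlowlyIncreasing α ε (fun x => ((Real.log x : ℝ) : ℂ) ^ p.2 / (p.2 ! : ℂ)) := by
    simpa only [smul_eq_mul, div_eq_mul_inv, add_zero] using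
      ((slowlyIncreasing_log_pow p.2 hε).anti hα1).smul hα (.const (p.2 ! : ℂ)⁻¹)
  simpa only [add_zero] using
    hcoeff.smul hα (hf p.1 (Finset.HasAntidiagonal.antidiagonal.fst_le hp))

end SlowlyIncreasing

section Summation

variable {E : Type*} [NormedAddCommGroup E] [CompleteSpace E]

theorem exists_norm_sum_sub_le_of_norm_le_sub {e : ℕ → E} {b : ℕ → ℝ} (hb : ∀ n, 0 ≤ b n)
    (he : ∀ n, ‖e n‖ ≤ b n - b (n + 1)) :
    ∃ c : E, ∀ N, ‖∑ n ∈ Finset.range N, e n - c‖ ≤ b N := by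
  have htel : ∀ {N M : ℕ}, N ≤ M → ∑ n ∈ Finset.Ico N M, ‖e n‖ ≤ b N - b M := fun {N M} hNM => by
    have hsum := Finset.sum_Ico_sub b hNM
    have hle := Finset.sum_le_sum fun n (_ : n ∈ Finset.Ico N M) => he n
    simp only [Finset.sum_sub_distrib] at hsum hle
    linarith
  have hsum : Summable fun n => ‖e n‖ :=
    summable_of_sum_range_le (c := b 0) (fun n => norm_nonneg _) fun n => by
      rw [Finset.range_eq_Ico]
      linarith [htel n.zero_le, hb n]
  refine ⟨∑' n, e n, fun N => ?_⟩
  have hlim := hsum.of_norm.hasSum.tendsto_sum_nat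
  refine le_of_tendsto ((tendsto_const_nhds.sub hlim).norm) ?_
  filter_upwards [eventually_ge_atTop N] with M hNM
  rw [norm_sub_rev, ← Finset.sum_Ico_eq_sub _ hNM]
  exact (norm_sum_le _ _).trans ((htel hNM).trans (by linarith [hb M]))

theorem rpow_sub_one_le_increment {r t : ℝ} (hr : r ≠ 0) (ht : 1 ≤ t) :
    t ^ (r - 1) ≤ 2 ^ |r - 1| * (((t + 1) ^ r - t ^ r) / r) := by
  have ht0 : 0 < t := one_pos.trans_le ht
  have hderiv : ∀ x : ℝ, 0 < x → HasDerivAt (fun x : ℝ => x ^ r / r) (x ^ (r - 1)) x :=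
    fun x hx => ((Real.hasDerivAt_rpow_const (Or.inl hx.ne')).div_const r).congr_deriv
      (mul_div_cancel_left₀ _ hr)
  obtain ⟨x, ⟨htx, hxt⟩, hslope⟩ := exists_hasDerivAt_eq_slope (fun x : ℝ => x ^ r / r)
    (fun x => x ^ (r - 1)) (lt_add_one t)
    (fun x hx => (hderiv x (ht0.trans_le hx.1)).continuousAt.continuousWithinAt)
    (fun x hx => hderiv x (ht0.trans hx.1))
  rw [add_sub_cancel_left, div_one, ← sub_div] at hslope
  rw [← hslope]
  exact rpow_le_two_rpow_abs_mul_rpow ht0 (ht0.trans htx) (by linarith) (by linarith) _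

/-- The terms are dominated by the increments of a multiple of `n ^ r`, so that the partial sums
are bounded by `n ^ r` if it increases, and converge with error of order `n ^ r` if it decreases. -/
theorem exists_sum_sub_isBigO_rpow {e : ℕ → E} {r : ℝ} (hr : r ≠ 0)
    (he : e =O[atTop] fun n => (n : ℝ) ^ (r - 1)) :
    ∃ c : E, (fun N : ℕ => ∑ n ∈ Finset.Ico 1 N, e n - c) =O[atTop] fun N => (N : ℝ) ^ r := by
  obtain ⟨C, hC, hbound⟩ := bound_of_isBigO_nat_atTop he
  let K := C * 2 ^ |r - 1| / r
  have hinc : ∀ n : ℕ, 1 ≤ n → ‖e n‖ ≤ K * ((n + 1 : ℕ) : ℝ) ^ r - K * (n : ℝ) ^ r := by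
    intro n hn
    have hn' : (1 : ℝ) ≤ n := by exact_mod_cast hn
    have hpos : 0 < (n : ℝ) ^ (r - 1) := by positivity
    calc ‖e n‖ ≤ C * (n : ℝ) ^ (r - 1) := by
          simpa only [Real.norm_of_nonneg hpos.le] using hbound hpos.ne'
      _ ≤ C * (2 ^ |r - 1| * (((n + 1 : ℝ) ^ r - (n : ℝ) ^ r) / r)) := by
        gcongr
        exact rpow_sub_one_le_increment hr hn'
      _ = K * ((n + 1 : ℕ) : ℝ) ^ r - K * (n : ℝ) ^ r := by
        simp only [K, Nat.cast_succ]
        ring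
  rcases hr.lt_or_gt with hneg | hpos
  · have hK : 0 ≤ -K := neg_nonneg.2 (div_nonpos_of_nonneg_of_nonpos (by positivity) hneg.le)
    obtain ⟨c, hc⟩ := exists_norm_sum_sub_le_of_norm_le_sub (e := fun n => e (1 + n))
      (b := fun n => -K * ((1 + n : ℕ) : ℝ) ^ r) (fun n => mul_nonneg hK (by positivity))
      (fun n => (hinc (1 + n) (by omega)).trans_eq (by rw [add_assoc]; ring))
    refine ⟨c, .of_bound (-K) (eventually_atTop.2 ⟨1, fun N hN => ?_⟩)⟩
    rw [Finset.sum_Ico_eq_sum_range, Real.norm_of_nonneg (by positivity)]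
    simpa only [Nat.add_sub_cancel' hN] using hc (N - 1)
  · have hK : 0 ≤ K := by positivity
    refine ⟨0, .of_bound K (eventually_atTop.2 ⟨1, fun N hN => ?_⟩)⟩
    rw [sub_zero, Real.norm_of_nonneg (by positivity)]
    calc ‖∑ n ∈ Finset.Ico 1 N, e n‖
        ≤ ∑ n ∈ Finset.Ico 1 N, (K * ((n + 1 : ℕ) : ℝ) ^ r - K * (n : ℝ) ^ r) :=
          norm_sum_le_of_le _ fun n hn => hinc n (Finset.mem_Ico.1 hn).1
      _ = K * (N : ℝ) ^ r - K * ((1 : ℕ) : ℝ) ^ r :=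
        Finset.sum_Ico_sub (fun n : ℕ => K * (n : ℝ) ^ r) hN
      _ ≤ K * (N : ℝ) ^ r := sub_le_self _ (mul_nonneg hK (by positivity))

theorem SlowlyIncreasing.exists_sum_sub_isBigO [NormedSpace ℝ E] {α r : ℝ} {F G : ℝ → E}
    (hF : SlowlyIncreasing α r F) (hr : r - α + 1 ≠ 0)
    (hG : ∀ x, 1 ≤ x → HasDerivAt G (F x) x) :
    ∃ c : E, (fun N : ℕ => ∑ n ∈ Finset.Ico 1 N, F n - (c + G N)) =O[atTop]
      fun N => (N : ℝ) ^ (r - α + 1) := by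
  obtain ⟨K, -, hF⟩ := hF
  have hstep : ∀ n : ℕ, 1 ≤ n → ‖F n - (G ((n + 1 : ℕ) : ℝ) - G n)‖ ≤ K * (n : ℝ) ^ (r - α) := by
    intro n hn
    have hn' : (1 : ℝ) ≤ n := by exact_mod_cast hn
    have hmean := norm_image_sub_le_of_norm_deriv_le_segment'
      (f := fun x : ℝ => G x - x • F n) (f' := fun x => F x - F n) (b := (n : ℝ) + 1)
      (fun x hx =>
        (((hG x (hn'.trans hx.1)).sub ((hasDerivAt_id x).smul_const (F n))).congr_deriv
          (by rw [one_smul])).hasDerivWithinAt)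
      (fun x hx => (hF n x hn' hx.1 hx.2.le).2) _ ⟨by linarith, le_rfl⟩
    rw [add_sub_cancel_left, mul_one, norm_sub_rev] at hmean
    refine le_of_eq_of_le (congrArg norm ?_) hmean
    push_cast
    module
  have hsteps : (fun n : ℕ => F n - (G ((n + 1 : ℕ) : ℝ) - G n)) =O[atTop]
      fun n => (n : ℝ) ^ (r - α + 1 - 1) := by
    refine .of_bound K (eventually_atTop.2 ⟨1, fun n hn => ?_⟩)
    rw [Real.norm_of_nonneg (by positivity), add_sub_cancel_right]
    exact hstep n hn
  obtain ⟨c, hc⟩ := exists_sum_sub_isBigO_rpow hr hsteps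
  refine ⟨c - G 1, hc.congr' (eventually_atTop.2 ⟨1, fun N hN => ?_⟩) .rfl⟩
  have htel := Finset.sum_Ico_sub (fun n : ℕ => G n) hN
  simp only [Finset.sum_sub_distrib] at htel ⊢
  rw [htel, Nat.cast_one]
  abel

theorem isBigO_natCast_rpow_of_le {a b : ℝ} (hab : a ≤ b) :
    (fun N : ℕ => (N : ℝ) ^ a) =O[atTop] fun N : ℕ => (N : ℝ) ^ b := by
  refine .of_bound' (eventually_atTop.2 ⟨1, fun N hN => ?_⟩)
  have hN' : (1 : ℝ) ≤ N := by exact_mod_cast hN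
  rw [Real.norm_of_nonneg (by positivity), Real.norm_of_nonneg (by positivity)]
  exact Real.rpow_le_rpow_of_exponent_le hN' hab

end Summation

section Main

variable {E : Type*} [NormedAddCommGroup E] [NormedSpace ℂ E] [CompleteSpace E]

theorem IsPeriodicChain.exists_sum_sub_isBigO {T α β : ℝ} {κ : ℂ} {f χ : ℕ → ℝ → E} {m : ℕ}
    (h : IsPeriodicChain T (κ + 1) f χ) (hα : 0 ≤ α) (hα1 : α ≤ 1) (hβα : β < α)
    (hf : ∀ j ≤ m, SlowlyIncreasing α 0 (fun x => f j (Real.log x))) :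
    ∃ c : E, (fun N : ℕ => ∑ n ∈ Finset.Ico 1 N, (n : ℂ) ^ κ • logPolynomial m f (Real.log n) -
        (c + (N : ℂ) ^ (κ + 1) • logPolynomial (m + 1) χ (Real.log N)))
      =O[atTop] fun N => (N : ℝ) ^ (κ.re + 1 - β) := by
  -- The powers of `log n` cost `n ^ (α - γ)`; avoiding `γ = Re κ + 1` rules out the error `log N`.
  obtain ⟨γ, ⟨hβγ, hγα⟩, hγ⟩ := (Set.Ioo_infinite hβα).exists_notMem_finset {κ.re + 1}
  have hexponent : κ.re + (α - γ) - α + 1 = κ.re + 1 - γ := by ring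
  have hslow := ((slowlyIncreasing_ofReal_cpow κ).anti hα1).smul hα
    (slowlyIncreasing_logPolynomial hα hα1 hf (sub_pos.2 hγα))
  obtain ⟨c, hc⟩ := hslow.exists_sum_sub_isBigO
    (hexponent ▸ sub_ne_zero.2 fun h => hγ (Finset.mem_singleton.2 h.symm)) fun x hx => by
      simpa only [add_sub_cancel_right] using
        h.hasDerivAt_cpow_smul_logPolynomial m (one_pos.trans_le hx)
  simp only [Complex.ofReal_natCast] at hc
  exact ⟨c, hc.trans (isBigO_natCast_rpow_of_le (by linarith))⟩

theorem mainTheorem2_general (κ : ℂ) (q : ℝ) (hq : 0 < q) (hq1 : q ≠ 1) (m : ℕ) (hm : 0 < m)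
    (α : ℝ≥0) (hα : 0 < α) (hα1 : α ≤ 1) (β : ℝ) (hβα : β < (α : ℝ)) (Φ : ℕ → ℝ → E)
    (hΦper : ∀ j < m, Function.Periodic (Φ j) 1)
    (hΦ : ∀ j < m, ∃ C : ℝ≥0, HolderWith C α (Φ j)) :
    ∃ (Ψ : ℤ → ℝ → E) (c : E),
      (∀ j : ℤ, -1 ≤ j → j < m → ContDiff ℝ 1 (Ψ j) ∧ Function.Periodic (Ψ j) 1) ∧
      ((fun N : ℕ =>
          (∑ n ∈ Finset.Ico 1 N, (n : ℂ) ^ κ •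
            ∑ p ∈ Finset.HasAntidiagonal.antidiagonal (m - 1),
              (((Real.log n : ℝ) : ℂ) ^ p.2 / (p.2 ! : ℂ)) • Φ p.1 (Real.logb q n))
          - (c + (N : ℂ) ^ (κ + 1) •
            ∑ p ∈ Finset.HasAntidiagonal.antidiagonal m,
              (((Real.log N : ℝ) : ℂ) ^ p.2 / (p.2 ! : ℂ)) •
                Ψ ((p.1 : ℤ) - 1) (Real.logb q N)))
        =O[atTop] fun N : ℕ => (N : ℝ) ^ (κ.re + 1 - β)) ∧
      (∀ ℓ : ℤ,
        (fun Z : ℂ =>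
          (∑ j ∈ Finset.range m, Z ^ j • fourierCoeffOn (zero_lt_one' ℝ) (Φ j) ℓ)
          - (κ + 1 + 2 * (ℓ : ℂ) * (Real.pi : ℂ) * Complex.I / ((Real.log q : ℝ) : ℂ) + Z) •
            ∑ j ∈ Finset.Ico (-1 : ℤ) (m : ℤ), Z ^ j • fourierCoeffOn (zero_lt_one' ℝ) (Ψ j) ℓ)
        =O[𝓝[≠] 0] fun Z : ℂ => Z ^ m) ∧
      ((q : ℂ) ^ (κ + 1) ≠ 1 → ∀ u : ℝ, Ψ (-1) u = 0) := by
  obtain ⟨k, rfl⟩ := Nat.exists_eq_add_one.2 hm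
  let L := Real.log q
  have hL : L ≠ 0 := Real.log_ne_zero_of_pos_of_ne_one hq hq1
  have hlog (x : ℝ) : L * Real.logb q x = Real.log x := mul_div_cancel₀ _ hL
  obtain ⟨f, χ, hχ, hf, hfΦ⟩ := exists_isPeriodicChain_rescale hL (κ + 1)
    (fun j hj => (hΦ j hj).elim fun C hC => hC.continuous hα) hΦper
  have hf_log {j : ℕ} (hj : j < k + 1) (x : ℝ) : f j (Real.log x) = Φ j (Real.logb q x) := by
    rw [← hlog, hfΦ j hj]
  have hf_slow (j : ℕ) (hj : j ≤ k) : SlowlyIncreasing α 0 (fun x => f j (Real.log x)) := by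
    have hj' : j < k + 1 := Nat.lt_succ_of_le hj
    obtain ⟨C, hC⟩ := hΦ j hj'
    simpa only [hf_log hj'] using slowlyIncreasing_comp_logb hC hα (hΦper j hj') q
  obtain ⟨c, hc⟩ := hχ.exists_sum_sub_isBigO α.coe_nonneg hα1 hβα hf_slow
  refine ⟨fun j u => χ (j + 1).toNat (L * u), c, fun j _ _ => ⟨?_, fun u => ?_⟩, ?_, fun ℓ => ?_,
    fun hres u => ?_⟩
  · exact (hχ.contDiff_one hf _).comp (contDiff_const.mul contDiff_id)
  · simpa only [mul_add, mul_one] using hχ.periodic _ (L * u)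
  · have hsum (x : ℝ) : logPolynomial k f (Real.log x) =
        ∑ p ∈ Finset.HasAntidiagonal.antidiagonal k,
          ((Real.log x : ℂ) ^ p.2 / (p.2 ! : ℂ)) • Φ p.1 (Real.logb q x) :=
      Finset.sum_congr rfl fun p hp => by
        rw [hf_log (Nat.lt_succ_of_le (Finset.HasAntidiagonal.antidiagonal.fst_le hp))]
    simp only [sub_add_cancel, Int.toNat_natCast, hlog, ← hsum, Nat.add_sub_cancel]
    exact hc
  · refine (hχ.isBigO_sum_fourierCoeffOn hL hf (k + 1) ℓ).congr_left fun Z => ?_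
    refine congrArg (· - _) (Finset.sum_congr rfl fun j hj => ?_)
    rw [funext (hfΦ j (Finset.mem_range.1 hj))]
  · have hres' : Complex.exp ((κ + 1) * L) ≠ 1 := by
      rwa [Complex.cpow_def_of_ne_zero (Complex.ofReal_ne_zero.2 hq.ne'),
        ← Complex.ofReal_log hq.le, mul_comm] at hres
    exact congrFun (hχ.zero_eq_zero hres') _

end Main

theorem mainTheorem2 (κ : ℂ) (q : ℝ) (hq : 1 < q) (m : ℕ) (hm : 0 < m)
    (α : ℝ≥0) (hα : 0 < α) (hα1 : α ≤ 1) (β : ℝ) (hβ : 0 < β) (hβα : β < (α : ℝ))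
    (Φ : ℕ → ℝ → ℂ)
    (hΦper : ∀ j < m, Function.Periodic (Φ j) 1)
    (hΦ : ∀ j < m, ∃ C : ℝ≥0, HolderWith C α (Φ j)) :
    ∃ (Ψ : ℤ → ℝ → ℂ) (c : ℂ),
      (∀ j : ℤ, -1 ≤ j → j < m → ContDiff ℝ 1 (Ψ j) ∧ Function.Periodic (Ψ j) 1) ∧
      -- the pairs `(j, k)` with `j + k = m - 1`, `0 ≤ j < m` on the left, and those with
      -- `j + k = m - 1`, `-1 ≤ j < m`, written as `(j + 1) + k = m`, on the right
      ((fun N : ℕ =>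
          (∑ n ∈ Finset.Ico 1 N, (n : ℂ) ^ κ *
            ∑ p ∈ Finset.HasAntidiagonal.antidiagonal (m - 1),
              ((Real.log n : ℝ) : ℂ) ^ p.2 / (p.2 ! : ℂ) * Φ p.1 (Real.logb q n))
          - (c + (N : ℂ) ^ (κ + 1) *
            ∑ p ∈ Finset.HasAntidiagonal.antidiagonal m,
              ((Real.log N : ℝ) : ℂ) ^ p.2 / (p.2 ! : ℂ) *
                Ψ ((p.1 : ℤ) - 1) (Real.logb q N)))
        =O[atTop] fun N : ℕ => (N : ℝ) ^ (κ.re + 1 - β)) ∧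
      (∀ ℓ : ℤ,
        (fun Z : ℂ =>
          (∑ j ∈ Finset.range m, periodicFourierCoeff (Φ j) ℓ * Z ^ j)
          - (κ + 1 + 2 * (ℓ : ℂ) * (Real.pi : ℂ) * Complex.I / ((Real.log q : ℝ) : ℂ) + Z) *
            ∑ j ∈ Finset.Ico (-1 : ℤ) (m : ℤ), periodicFourierCoeff (Ψ j) ℓ * Z ^ j)
        =O[𝓝[≠] 0] fun Z : ℂ => Z ^ m) ∧
      ((q : ℂ) ^ (κ + 1) ≠ 1 → ∀ u : ℝ, Ψ (-1) u = 0) := by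
  obtain ⟨Ψ, c, hΨ, hsum, hcoeff, hzero⟩ :=
    mainTheorem2_general κ q (one_pos.trans hq) hq.ne' m hm α hα hα1 β hβα Φ hΦper hΦ
  exact ⟨Ψ, c, hΨ, hsum, fun ℓ => by
    simpa only [periodicFourierCoeff_eq_fourierCoeffOn, smul_eq_mul, mul_comm]
      using hcoeff ℓ, hzero⟩
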